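/- Let $\Omega=[0,1]^2$ with periodic boundary conditions, let $\dot H^1=\{u\in H^1(\Omega):\int_\Omega u\,dx=0\}$, and for $\theta\in\dot H^1$ put $v=\nabla^\perp\psi=(-\partial_2\psi,\partial_1\psi)$, where $(-\Delta)^{1/2}\psi=\theta$ and $\int_\Omega\psi\,dx=0$. Let $T>0$ and let $\theta_0\in H^2(\Omega)\cap\dot H^1$. Let $\bar\theta\in C([-T,T],H^2\cap\dot H^1)\cap C^1([-T,T],\dot H^1)$ be a regular solution on $[-T,T]$ of the surface quasi-geostrophic equation $$\partial_t\bar\theta+\operatorname{div}(\bar v\,\bar\theta)=0,\qquad \bar v=\nabla^\perp(-\Delta)^{-1/2}\bar\theta,\qquad \bar\theta(0)=\theta_0 .$$ For $\alpha>0$ let $\theta^\alpha\in C^1([-T,T],\dot H^1)$ denote the solution of the regularized problem $$\partial_t\big((1-\alpha^2\Delta)\theta^\alpha\big)+\operatorname{div}(v^\alpha\theta^\alpha)=0,\qquad v^\alpha=\nabla^\perp(-\Delta)^{-1/2}\theta^\alpha,\qquad \theta^\alpha(0)=\theta_0 ,$$ the equation being understood in the sense of distributions on $\Omega$ at every time.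 Then $$\lim_{\alpha\to0^+}\Big(\|\bar\theta(t)-\theta^\alpha(t)\|_{L^2}^2+\alpha^2\|\nabla(\bar\theta(t)-\theta^\alpha(t))\|_{L^2}^2\Big)=0\quad\text{uniformly in }t\in[-T,T].$$ -/

import Mathlib

open MeasureTheory Set
open scoped ContDiff

noncomputable section

namespace SQG

/-- The periodic unit square `ℝ² / ℤ²`. -/
abbrev Torus : Type := UnitAddTorus (Fin 2)

/-- Lebesgue measure on the periodic unit square (total mass `1`). -/
abbrev μ : Measure Torus := Measure.pi fun _ : Fin 2 => AddCircle.haarAddCircle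

/-- Real `L²(Ω)`. Its norm is the `L²` norm. -/
abbrev L2 : Type := Lp ℝ 2 μ

/-! ### Smooth periodic test functions and their classical derivatives -/

/-- `φ` is a smooth periodic function: its lift to `ℝ²` is `C^∞`. -/
def IsTest (φ : Torus → ℝ) : Prop :=
  ContDiff ℝ ∞ fun y : Fin 2 → ℝ => φ fun i => (y i : UnitAddCircle)

/-- Classical partial derivative of a periodic function in the direction of the `j`-th axis. -/
def partialDeriv (j : Fin 2) (φ : Torus → ℝ) (x : Torus) : ℝ :=
  deriv (fun s : ℝ => φ (x + Pi.single j (s : UnitAddCircle))) 0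

/-- Classical Laplacian of a periodic function. -/
def laplacian (φ : Torus → ℝ) (x : Torus) : ℝ :=
  ∑ j, partialDeriv j (partialDeriv j φ) x

/-! ### Weak derivatives and Sobolev spaces -/

/-- `g = ∂ⱼ f` weakly. -/
def HasWeakPartial (j : Fin 2) (f g : L2) : Prop :=
  ∀ φ, IsTest φ → ∫ x, f x * partialDeriv j φ x ∂μ = -∫ x, g x * φ x ∂μ

open Classical in
/-- The weak derivative `∂ⱼ f` in `L²`; it is used only for functions `f` that have one. -/
def weakPartial (j : Fin 2) (f : L2) : L2 :=
  if h : ∃ g, HasWeakPartial j f g then h.choose else 0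

/-- `f ∈ H¹(Ω)`. -/
def MemH1 (f : L2) : Prop := ∀ j, ∃ g, HasWeakPartial j f g

/-- `f ∈ H²(Ω)`. -/
def MemH2 (f : L2) : Prop := MemH1 f ∧ ∀ j, MemH1 (weakPartial j f)

/-- `∫ f = 0`. -/
def MeanZero (f : L2) : Prop := ∫ x, f x ∂μ = 0

/-- `‖∇ f‖²` in `L²(Ω)`. -/
def gradNormSq (f : L2) : ℝ := ∑ j, ‖weakPartial j f‖ ^ 2

/-- `θ ∈ C¹(I, Ḣ¹)`: all values are of zero mean and in `H¹`, and `θ` and its weak derivatives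
of first order are `C¹` curves in `L²`. -/
structure IsC1H1 (I : Set ℝ) (θ : ℝ → L2) : Prop where
  mean_zero : ∀ t ∈ I, MeanZero (θ t)
  memH1 : ∀ t ∈ I, MemH1 (θ t)
  contDiffOn : ContDiffOn ℝ 1 θ I
  contDiffOn_weakPartial : ∀ j, ContDiffOn ℝ 1 (fun t => weakPartial j (θ t)) I

/-- `θ ∈ C(I, H²)`: all values are in `H²`, and `θ` and its weak derivatives of order at most
two are continuous curves in `L²`. -/
structure IsC0H2 (I : Set ℝ) (θ : ℝ → L2) : Prop where
  memH2 : ∀ t ∈ I, MemH2 (θ t)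
  continuousOn : ContinuousOn θ I
  continuousOn_weakPartial : ∀ j, ContinuousOn (fun t => weakPartial j (θ t)) I
  continuousOn_weakPartial₂ :
    ∀ i j, ContinuousOn (fun t => weakPartial i (weakPartial j (θ t))) I

/-! ### Stream function and velocity -/

/-- The Fourier coefficient `∫ f(x) exp(-2πi k·x) dx`. -/
def coeff (f : L2) (k : Fin 2 → ℤ) : ℂ :=
  UnitAddTorus.mFourierCoeff (fun x => ((f x : ℝ) : ℂ)) k

/-- `(-Δ)^{1/2} ψ = θ`. On the unit square the wave vectors are `2πk` with `k ∈ ℤ²`. -/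
def IsHalfLaplacian (ψ θ : L2) : Prop :=
  ∀ k : Fin 2 → ℤ,
    coeff θ k = ((2 * Real.pi * √((k 0 : ℝ) ^ 2 + (k 1 : ℝ) ^ 2) : ℝ) : ℂ) * coeff ψ k

/-- `v = ∇^⊥ ψ = (-∂₂ψ, ∂₁ψ)`, where `(-Δ)^{1/2} ψ = θ` and `∫ ψ = 0`. -/
def IsVelocity (θ : L2) (v : Fin 2 → L2) : Prop :=
  ∃ ψ : L2, MemH1 ψ ∧ MeanZero ψ ∧ IsHalfLaplacian ψ θ ∧
    v 0 = -weakPartial 1 ψ ∧ v 1 = weakPartial 0 ψ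

/-- The action `∫ θ v·∇φ` of the distribution `-div (v θ)` on a test function `φ`. -/
def negDiv (v : Fin 2 → L2) (θ : L2) (φ : Torus → ℝ) : ℝ :=
  ∑ j, ∫ x, θ x * v j x * partialDeriv j φ x ∂μ

/-- The action of the distribution `(1 - a² Δ) θ` on a test function `φ`. -/
def helmholtz (a : ℝ) (θ : L2) (φ : Torus → ℝ) : ℝ :=
  ∫ x, θ x * (φ x - a ^ 2 * laplacian φ x) ∂μ

/-! ### The two initial value problems on `[-T, T]` -/

/-- `θ` is a regular (`H²`) solution on `[-T, T]` of the SQG equation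
`∂ₜ θ + div (v θ) = 0`, `v = ∇^⊥ (-Δ)^{-1/2} θ`, with `θ(0) = θ₀`:
it lies in `C([-T,T], H² ∩ Ḣ¹) ∩ C¹([-T,T], Ḣ¹)`, and the equation holds at every time. -/
structure IsRegularSolution (T : ℝ) (θ₀ : L2) (θ : ℝ → L2) : Prop where
  c0h2 : IsC0H2 (Icc (-T) T) θ
  c1h1 : IsC1H1 (Icc (-T) T) θ
  initial : θ 0 = θ₀
  equation : ∀ t ∈ Icc (-T) T, ∃ v, IsVelocity (θ t) v ∧ ∀ φ, IsTest φ →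
    HasDerivWithinAt (fun s => ∫ x, θ s x * φ x ∂μ) (negDiv v (θ t) φ) (Icc (-T) T) t

/-- `θ` is a solution on `[-T, T]`, in `C¹([-T,T], Ḣ¹)`, of the regularized problem
`∂ₜ (1 - a² Δ) θ + div (v θ) = 0`, `v = ∇^⊥ (-Δ)^{-1/2} θ`, with `θ(0) = θ₀`. -/
structure IsRegularizedSolution (a T : ℝ) (θ₀ : L2) (θ : ℝ → L2) : Prop where
  c1h1 : IsC1H1 (Icc (-T) T) θ
  initial : θ 0 = θ₀
  equation : ∀ t ∈ Icc (-T) T, ∃ v, IsVelocity (θ t) v ∧ ∀ φ, IsTest φ →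
    HasDerivWithinAt (fun s => helmholtz a (θ s) φ) (negDiv v (θ t) φ) (Icc (-T) T) t

end SQG

end

noncomputable section

namespace SQG

open UnitAddTorus
open scoped ComplexConjugate

/-! The proof is an energy estimate for w = θ̄ - θ^α, carried out on Fourier coefficients. Let B(f,
g) = -div(v_f g), where v_f is the velocity of f. Subtracting the equations and pairing with w shows
that half the derivative of E = ‖w‖² + α²‖∇w‖² is ⟨w, B(θ̄, θ̄) - B(θ^α, θ^α)⟩ + α²⟨∇w, ∇∂ₜθ̄⟩
(`energy_balance`).

The quadratic difference is B(θ^α, w) + B(w, θ̄). The first term is orthogonal to w because the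
velocity is divergence free (`tsum_triTerm_self`). For the second, a direct bound would need ∇θ̄ in
L^∞, which H² does not give in two dimensions. Instead ⟨w, B(w, θ̄)⟩ is symmetrized in its two
copies of w: the symbol 1/|p| becomes 1/|p| - 1/|p+q|, and this commutator moves one derivative onto
θ̄ (`abs_cross_mul_abs_inv_sub_inv_le`). What remains is controlled by a trilinear lattice estimate
(`summable_tsum_div_max_le`), giving C‖w‖²‖Δθ̄‖ (`norm_tsum_triTerm_le`).

Hence |E'| ≤ K E + α²N, with K and N depending only on θ̄ and T (`abs_energy_deriv_le`). Since E(0)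
= 0, Grönwall's inequality in both time directions yields E = O(α²) uniformly on [-T, T]. -/

/-! ### Fourier coefficients and Parseval's identity for real L² functions -/

/-- Complexification of a real `L²` function. -/
def complexify : L2 →L[ℝ] Lp ℂ 2 μ := Complex.ofRealCLM.compLpL 2 μ

theorem coeFn_complexify (f : L2) : complexify f =ᵐ[μ] fun x => ((f x : ℝ) : ℂ) :=
  Complex.ofRealCLM.coeFn_compLpL f

theorem mFourierCoeff_congr_ae {f g : Torus → ℂ} (h : f =ᵐ[μ] g) (k : Fin 2 → ℤ) :
    mFourierCoeff f k = mFourierCoeff g k := by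
  refine integral_congr_ae ?_
  filter_upwards [h] with x hx
  rw [hx]

theorem coeff_eq_integral (f : L2) (k : Fin 2 → ℤ) :
    coeff f k = ∫ x, mFourier (-k) x * ((f x : ℝ) : ℂ) ∂μ := rfl

theorem coeff_eq_mFourierCoeff (f : L2) (k : Fin 2 → ℤ) :
    coeff f k = mFourierCoeff (complexify f) k :=
  (mFourierCoeff_congr_ae (coeFn_complexify f) k).symm

/-- A Fourier coefficient as a continuous real-linear functional. -/
def coeffCLM (k : Fin 2 → ℤ) : L2 →L[ℝ] ℂ :=
  ((innerSL ℂ (mFourierLp 2 k : Lp ℂ 2 μ)).restrictScalars ℝ).comp complexify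

theorem coeffCLM_apply (k : Fin 2 → ℤ) (f : L2) : coeffCLM k f = coeff f k := by
  rw [coeff_eq_mFourierCoeff]
  have h := mFourierBasis_repr (complexify f) k
  rw [← h, HilbertBasis.repr_apply_apply, coe_mFourierBasis]
  rfl

theorem coeff_sub (f g : L2) (k : Fin 2 → ℤ) : coeff (f - g) k = coeff f k - coeff g k := by
  simp only [← coeffCLM_apply, map_sub]

theorem coeff_neg_left (f : L2) (k : Fin 2 → ℤ) : coeff (-f) k = -coeff f k := by
  simp only [← coeffCLM_apply, map_neg]

theorem coeff_neg (f : L2) (k : Fin 2 → ℤ) : coeff f (-k) = conj (coeff f k) := by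
  rw [coeff_eq_integral, coeff_eq_integral, ← integral_conj]
  refine integral_congr_ae (.of_forall fun x => ?_)
  simp only [map_mul, Complex.conj_ofReal, ← mFourier_neg]

theorem MeanZero.coeff_zero {f : L2} (hf : MeanZero f) : coeff f 0 = 0 := by
  rw [coeff_eq_integral]
  simp only [neg_zero, mFourier_zero, ContinuousMap.one_apply, one_mul]
  rw [integral_complex_ofReal, show ∫ x, f x ∂μ = 0 from hf, Complex.ofReal_zero]

theorem hasSum_conj_coeff_mul (f g : L2) :
    HasSum (fun k => conj (coeff f k) * coeff g k) ((inner ℝ f g : ℝ) : ℂ) := by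
  have h := hasSum_prod_mFourierCoeff (complexify f) (complexify g)
  simp only [← coeff_eq_mFourierCoeff] at h
  convert h using 1
  rw [L2.inner_def, ← integral_complex_ofReal]
  refine integral_congr_ae ?_
  filter_upwards [coeFn_complexify f, coeFn_complexify g] with x hf hg
  rw [hf, hg, Complex.conj_ofReal, ← Complex.ofReal_mul]
  simp [mul_comm]

theorem hasSum_re_conj_coeff_mul (f g : L2) :
    HasSum (fun k => (conj (coeff f k) * coeff g k).re) (inner ℝ f g : ℝ) := by
  simpa using Complex.hasSum_re (hasSum_conj_coeff_mul f g)

theorem hasSum_norm_coeff_sq (f : L2) : HasSum (fun k => ‖coeff f k‖ ^ 2) (‖f‖ ^ 2) := by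
  have h := hasSum_re_conj_coeff_mul f f
  rw [real_inner_self_eq_norm_sq] at h
  refine h.congr_fun fun k => ?_
  rw [← Complex.normSq_eq_conj_mul_self, Complex.ofReal_re, Complex.normSq_eq_norm_sq]

theorem ext_coeff {f g : L2} (h : ∀ k, coeff f k = coeff g k) : f = g := by
  have h1 := hasSum_norm_coeff_sq (f - g)
  simp only [coeff_sub, h, sub_self, norm_zero, ne_eq, OfNat.ofNat_ne_zero, not_false_eq_true,
    zero_pow] at h1
  have h2 := h1.unique hasSum_zero
  exact sub_eq_zero.1 (norm_eq_zero.1 (by simpa using h2))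

/-- Parseval applied to f and e_{-k} g, both in L²; reality of f turns the conjugated coefficient at
p into the coefficient at -p. This makes sense of the convolution although f g is only in L¹. -/
theorem hasSum_coeff_mul (f g : L2) (k : Fin 2 → ℤ) :
    HasSum (fun p => coeff f p * coeff g (k - p))
      (∫ x, mFourier (-k) x * ((g x * f x : ℝ) : ℂ) ∂μ) := by
  have hmem : MemLp (fun x => mFourier (-k) x * ((g x : ℝ) : ℂ)) 2 μ := by
    have hg : MemLp (fun x => ((g x : ℝ) : ℂ)) 2 μ := (Lp.memLp g).ofReal
    refine hg.of_le ?_ (.of_forall fun x => ?_)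
    · exact (mFourier (-k)).continuous.aestronglyMeasurable.mul hg.1
    · rw [norm_mul]
      have := (mFourier (-k)).norm_coe_le_norm x
      rw [mFourier_norm] at this
      exact mul_le_of_le_one_left (norm_nonneg _) this
  have h := hasSum_prod_mFourierCoeff (complexify f) (hmem.toLp _)
  have h1 : ∀ p, mFourierCoeff (hmem.toLp _) p = coeff g (k + p) := by
    intro p
    rw [mFourierCoeff_congr_ae hmem.coeFn_toLp, coeff_eq_integral]
    refine integral_congr_ae (.of_forall fun x => ?_)
    simp only [smul_eq_mul, ← mul_assoc, ← mFourier_add, neg_add]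
    rw [add_comm]
  simp only [← coeff_eq_mFourierCoeff, h1, ← coeff_neg] at h
  rw [← (Equiv.neg (Fin 2 → ℤ)).hasSum_iff]
  convert h using 1
  · funext p
    simp
  · refine integral_congr_ae ?_
    filter_upwards [coeFn_complexify f, hmem.coeFn_toLp] with x hf hg
    rw [hf, hg, Complex.conj_ofReal]
    push_cast
    ring

/-! ### Trigonometric test functions -/

theorem mFourier_apply_coe (k : Fin 2 → ℤ) (y : Fin 2 → ℝ) :
    mFourier k (fun i => (y i : UnitAddCircle)) =
      Complex.exp (2 * Real.pi * Complex.I * ∑ i, (k i : ℂ) * (y i : ℂ)) := by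
  simp only [mFourier, ContinuousMap.coe_mk, fourier_coe_apply, Complex.ofReal_one, div_one,
    ← Complex.exp_sum, Finset.mul_sum]
  congr 1
  exact Finset.sum_congr rfl fun i _ => by ring

theorem mFourier_add_single (k : Fin 2 → ℤ) (x : Torus) (j : Fin 2) (s : ℝ) :
    mFourier k (x + Pi.single j (s : UnitAddCircle)) =
      mFourier k x * Complex.exp (2 * Real.pi * Complex.I * k j * s) := by
  have h : mFourier k (x + Pi.single j (s : UnitAddCircle)) =
      mFourier k x * mFourier k (Pi.single j (s : UnitAddCircle)) := by
    simp only [mFourier, ContinuousMap.coe_mk, ← Finset.prod_mul_distrib, Pi.add_apply,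
      fourier_apply, smul_add, AddCircle.toCircle_add, Circle.coe_mul]
  rw [h]
  congr 1
  have h2 : (Pi.single j (s : UnitAddCircle) : Torus) =
      fun i => ((Pi.single j s : Fin 2 → ℝ) i : UnitAddCircle) := by
    funext i
    by_cases hi : i = j
    · subst hi; simp
    · simp [hi]
  rw [h2, mFourier_apply_coe]
  congr 1
  rw [Finset.sum_eq_single j]
  · simp [mul_assoc]
  · intro i _ hi
    simp [hi]
  · simp

theorem contDiff_mFourier (k : Fin 2 → ℤ) :
    ContDiff ℝ ∞ fun y : Fin 2 → ℝ => mFourier k fun i => (y i : UnitAddCircle) := by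
  simp only [mFourier_apply_coe]
  refine ContDiff.cexp (contDiff_const.mul (ContDiff.sum fun i _ => contDiff_const.mul ?_))
  exact Complex.ofRealCLM.contDiff.comp (contDiff_apply ℝ ℝ i)

theorem isTest_re_mFourier (k : Fin 2 → ℤ) : IsTest fun x => (mFourier k x).re :=
  Complex.reCLM.contDiff.comp (contDiff_mFourier k)

theorem isTest_im_mFourier (k : Fin 2 → ℤ) : IsTest fun x => (mFourier k x).im :=
  Complex.imCLM.contDiff.comp (contDiff_mFourier k)

theorem hasDerivAt_mFourier (k : Fin 2 → ℤ) (x : Torus) (j : Fin 2) :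
    HasDerivAt (fun s : ℝ => mFourier k (x + Pi.single j (s : UnitAddCircle)))
      (mFourier k x * (2 * Real.pi * Complex.I * k j)) 0 := by
  simp only [mFourier_add_single]
  have h1 : HasDerivAt (fun s : ℝ => 2 * Real.pi * Complex.I * k j * (s : ℂ))
      (2 * Real.pi * Complex.I * k j * 1) 0 :=
    (Complex.ofRealCLM.hasDerivAt (x := (0 : ℝ))).const_mul _
  simpa using (h1.cexp).const_mul (mFourier k x)

theorem partialDeriv_re_mFourier (k : Fin 2 → ℤ) (j : Fin 2) (x : Torus) :
    partialDeriv j (fun x => (mFourier (-k) x).re) x = 2 * Real.pi * k j * (mFourier (-k) x).im := by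
  have h := Complex.reCLM.hasFDerivAt.comp_hasDerivAt (0 : ℝ) (hasDerivAt_mFourier (-k) x j)
  refine h.deriv.trans ?_
  simp [Complex.mul_re]
  ring

theorem partialDeriv_im_mFourier (k : Fin 2 → ℤ) (j : Fin 2) (x : Torus) :
    partialDeriv j (fun x => (mFourier (-k) x).im) x =
      -(2 * Real.pi * k j) * (mFourier (-k) x).re := by
  have h := Complex.imCLM.hasFDerivAt.comp_hasDerivAt (0 : ℝ) (hasDerivAt_mFourier (-k) x j)
  refine h.deriv.trans ?_
  simp [Complex.mul_im]
  ring

theorem partialDeriv_const_mul (c : ℝ) (φ : Torus → ℝ) (j : Fin 2) (x : Torus) :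
    partialDeriv j (fun x => c * φ x) x = c * partialDeriv j φ x := by
  simp [partialDeriv]

/-- The squared length of a wave vector of the unit square. -/
def normSq (k : Fin 2 → ℤ) : ℝ := (k 0 : ℝ) ^ 2 + (k 1 : ℝ) ^ 2

theorem laplacian_re_mFourier (k : Fin 2 → ℤ) (x : Torus) :
    laplacian (fun x => (mFourier (-k) x).re) x =
      -(4 * Real.pi ^ 2 * normSq k) * (mFourier (-k) x).re := by
  simp only [laplacian, Fin.sum_univ_two, normSq, funext (partialDeriv_re_mFourier k _),
    partialDeriv_const_mul, partialDeriv_im_mFourier]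
  ring

theorem laplacian_im_mFourier (k : Fin 2 → ℤ) (x : Torus) :
    laplacian (fun x => (mFourier (-k) x).im) x =
      -(4 * Real.pi ^ 2 * normSq k) * (mFourier (-k) x).im := by
  simp only [laplacian, Fin.sum_univ_two, normSq, funext (partialDeriv_im_mFourier k _),
    partialDeriv_const_mul, partialDeriv_re_mFourier]
  ring

theorem integrable_mFourier_mul {f : Torus → ℝ} (hf : Integrable f μ) (k : Fin 2 → ℤ) :
    Integrable (fun x => mFourier k x * (f x : ℂ)) μ := by
  have hc : Integrable (fun x => (f x : ℂ)) μ := hf.ofReal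
  refine hc.mono ?_ (.of_forall fun x => ?_)
  · exact (mFourier k).continuous.aestronglyMeasurable.mul hc.1
  · rw [norm_mul]
    have := (mFourier k).norm_coe_le_norm x
    rw [mFourier_norm] at this
    exact mul_le_of_le_one_left (norm_nonneg _) this

theorem integral_mul_re_mFourier {f : Torus → ℝ} (hf : Integrable f μ) (k : Fin 2 → ℤ) :
    ∫ x, f x * (mFourier k x).re ∂μ = (∫ x, mFourier k x * (f x : ℂ) ∂μ).re := by
  have h := integral_re (integrable_mFourier_mul hf k)
  refine Eq.trans ?_ h
  refine integral_congr_ae (.of_forall fun x => ?_)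
  simp [mul_comm]

theorem integral_mul_im_mFourier {f : Torus → ℝ} (hf : Integrable f μ) (k : Fin 2 → ℤ) :
    ∫ x, f x * (mFourier k x).im ∂μ = (∫ x, mFourier k x * (f x : ℂ) ∂μ).im := by
  have h := integral_im (integrable_mFourier_mul hf k)
  refine Eq.trans ?_ h
  refine integral_congr_ae (.of_forall fun x => ?_)
  simp [mul_comm]

theorem integrable_coeFn (f : L2) : Integrable (f : Torus → ℝ) μ :=
  (Lp.memLp f).integrable (by norm_num)

theorem integrable_mul_coeFn (f g : L2) : Integrable (fun x => f x * g x) μ :=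
  (Lp.memLp f).integrable_mul (Lp.memLp g)

theorem integral_mul_re_eq_coeff (f : L2) (k : Fin 2 → ℤ) :
    ∫ x, f x * (mFourier (-k) x).re ∂μ = (coeff f k).re :=
  integral_mul_re_mFourier (integrable_coeFn f) _

theorem integral_mul_im_eq_coeff (f : L2) (k : Fin 2 → ℤ) :
    ∫ x, f x * (mFourier (-k) x).im ∂μ = (coeff f k).im :=
  integral_mul_im_mFourier (integrable_coeFn f) _

/-! ### Weak derivatives in terms of Fourier coefficients -/

/-- Test functions are real, so the real and imaginary parts of e_{-k} are tested separately and
then recombined. -/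
theorem HasWeakPartial.coeff_eq {j : Fin 2} {f g : L2} (h : HasWeakPartial j f g)
    (k : Fin 2 → ℤ) : coeff g k = 2 * Real.pi * Complex.I * k j * coeff f k := by
  have h1 := h _ (isTest_re_mFourier (-k))
  have h2 := h _ (isTest_im_mFourier (-k))
  simp only [partialDeriv_re_mFourier, partialDeriv_im_mFourier, mul_left_comm (f _ : ℝ),
    integral_const_mul, integral_mul_re_eq_coeff, integral_mul_im_eq_coeff] at h1 h2
  apply Complex.ext
  · simp [Complex.mul_re]
    linarith
  · simp [Complex.mul_im]
    linarith

theorem MemH1.hasWeakPartial {f : L2} (hf : MemH1 f) (j : Fin 2) :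
    HasWeakPartial j f (weakPartial j f) := by
  rw [weakPartial, dif_pos (hf j)]
  exact (hf j).choose_spec

theorem MemH1.coeff_weakPartial {f : L2} (hf : MemH1 f) (j : Fin 2) (k : Fin 2 → ℤ) :
    coeff (weakPartial j f) k = 2 * Real.pi * Complex.I * k j * coeff f k :=
  (hf.hasWeakPartial j).coeff_eq k

/-- Weak derivatives are unique, having prescribed Fourier coefficients, so the choice inside
`weakPartial` is harmless. -/
theorem HasWeakPartial.weakPartial_eq {j : Fin 2} {f g : L2} (h : HasWeakPartial j f g) :
    weakPartial j f = g := by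
  have h' : HasWeakPartial j f (weakPartial j f) := by
    have he : ∃ g, HasWeakPartial j f g := ⟨g, h⟩
    rw [weakPartial, dif_pos he]
    exact he.choose_spec
  exact ext_coeff fun k => by rw [h.coeff_eq, h'.coeff_eq]

theorem isQuotientMap_coe :
    Topology.IsQuotientMap fun (y : Fin 2 → ℝ) (i : Fin 2) => (y i : UnitAddCircle) :=
  (IsOpenQuotientMap.piMap fun _ => QuotientAddGroup.isOpenQuotientMap_mk).isQuotientMap

/-- Smoothness is a condition on the lift to the plane; continuity descends because the covering map
is a quotient map. -/
theorem IsTest.continuous {φ : Torus → ℝ} (h : IsTest φ) : Continuous φ :=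
  isQuotientMap_coe.continuous_iff.2 (ContDiff.continuous h)

theorem IsTest.partialDeriv {φ : Torus → ℝ} (h : IsTest φ) (j : Fin 2) :
    IsTest (partialDeriv j φ) := by
  have h1 : ∀ y : Fin 2 → ℝ, SQG.partialDeriv j φ (fun i => (y i : UnitAddCircle)) =
      fderiv ℝ (fun y : Fin 2 → ℝ => φ fun i => (y i : UnitAddCircle)) y (Pi.single j 1) := by
    intro y
    have hd := (h.differentiable (by simp) (y + (0 : ℝ) • Pi.single j 1)).hasFDerivAt
    have hl : HasDerivAt (fun s : ℝ => y + s • (Pi.single j 1 : Fin 2 → ℝ)) (Pi.single j 1) 0 := by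
      simpa using ((hasDerivAt_id (0 : ℝ)).smul_const (Pi.single j 1 : Fin 2 → ℝ)).const_add y
    have := (hd.comp_hasDerivAt (0 : ℝ) hl).deriv
    rw [zero_smul, add_zero] at this
    rw [← this, SQG.partialDeriv]
    congr 1
    funext s
    simp only [Function.comp]
    congr 1
    funext i
    by_cases hi : i = j
    · subst hi; simp
    · simp [hi]
  unfold IsTest
  simp only [h1]
  exact (h.fderiv_right (m := ∞) (by simp)).clm_apply contDiff_const

theorem IsTest.integrable_mul {φ : Torus → ℝ} (h : IsTest φ) (f : L2) :
    Integrable (fun x => f x * φ x) μ := by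
  refine (integrable_coeFn f).mul_bdd (c := ‖(⟨φ, h.continuous⟩ : C(Torus, ℝ))‖)
    h.continuous.aestronglyMeasurable (.of_forall fun x => ?_)
  exact (⟨φ, h.continuous⟩ : C(Torus, ℝ)).norm_coe_le_norm x

theorem integral_sub_mul {φ : Torus → ℝ} (h : IsTest φ) (f g : L2) :
    ∫ x, (f - g : L2) x * φ x ∂μ = ∫ x, f x * φ x ∂μ - ∫ x, g x * φ x ∂μ := by
  rw [← integral_sub (h.integrable_mul f) (h.integrable_mul g)]
  refine integral_congr_ae ?_
  filter_upwards [Lp.coeFn_sub f g] with x hx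
  rw [hx, Pi.sub_apply, sub_mul]

theorem HasWeakPartial.sub {j : Fin 2} {f g f' g' : L2} (hf : HasWeakPartial j f f')
    (hg : HasWeakPartial j g g') : HasWeakPartial j (f - g) (f' - g') := by
  intro φ hφ
  rw [integral_sub_mul (hφ.partialDeriv j), integral_sub_mul hφ, hf φ hφ, hg φ hφ]
  ring

theorem MemH1.sub {f g : L2} (hf : MemH1 f) (hg : MemH1 g) : MemH1 (f - g) := fun j =>
  ⟨_, (hf.hasWeakPartial j).sub (hg.hasWeakPartial j)⟩

theorem MemH1.weakPartial_sub {f g : L2} (hf : MemH1 f) (hg : MemH1 g) (j : Fin 2) :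
    weakPartial j (f - g) = weakPartial j f - weakPartial j g :=
  ((hf.hasWeakPartial j).sub (hg.hasWeakPartial j)).weakPartial_eq

/-! ### The equations in terms of Fourier coefficients -/

/-- The length of a wave vector of the unit square. -/
def len (k : Fin 2 → ℤ) : ℝ := √(normSq k)

/-- The planar cross product of two wave vectors. -/
def cross (p q : Fin 2 → ℤ) : ℝ := p 0 * q 1 - p 1 * q 0

theorem IsVelocity.coeff_eq {θ : L2} {v : Fin 2 → L2} (h : IsVelocity θ v) (k : Fin 2 → ℤ) :
    coeff (v 0) k = -(Complex.I * k 1 / len k) * coeff θ k ∧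
      coeff (v 1) k = Complex.I * k 0 / len k * coeff θ k := by
  obtain ⟨ψ, hψ, hmean, hhalf, h0, h1⟩ := h
  have hk : coeff θ k = ((2 * Real.pi * len k : ℝ) : ℂ) * coeff ψ k := hhalf k
  rw [h0, h1, coeff_neg_left, hψ.coeff_weakPartial, hψ.coeff_weakPartial, hk]
  -- At k = 0 the divisions by `len k` take the default value 0, which is correct: every coefficient
  -- involved vanishes there.
  by_cases hl : len k = 0
  · have hk0 : k = 0 := by
      have : normSq k = 0 := (Real.sqrt_eq_zero (by unfold normSq; positivity)).1 hl
      unfold normSq at this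
      have h2 : (k 0 : ℝ) = 0 := by nlinarith [sq_nonneg (k 0 : ℝ), sq_nonneg (k 1 : ℝ)]
      have h3 : (k 1 : ℝ) = 0 := by nlinarith [sq_nonneg (k 0 : ℝ), sq_nonneg (k 1 : ℝ)]
      funext i
      fin_cases i
      · exact_mod_cast h2
      · exact_mod_cast h3
    subst hk0
    simp
  · have : (len k : ℂ) ≠ 0 := by exact_mod_cast hl
    push_cast
    constructor <;> field_simp

/-- The Fourier symbol of `-div (v θ)` as a bilinear form in `(θ, θ)`. -/
def symb (p q : Fin 2 → ℤ) : ℝ := 2 * Real.pi * (cross p q / len p)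

theorem hasSum_negDiv {θ : L2} {v : Fin 2 → L2} (h : IsVelocity θ v) (k : Fin 2 → ℤ) :
    HasSum (fun p => (symb p (k - p) : ℂ) * coeff θ p * coeff θ (k - p))
      (negDiv v θ (fun x => (mFourier (-k) x).re) +
        negDiv v θ (fun x => (mFourier (-k) x).im) * Complex.I) := by
  have hs : ∀ j, HasSum (fun p => -(2 * Real.pi * Complex.I * k j) *
      (coeff (v j) p * coeff θ (k - p)))
      (-(2 * Real.pi * Complex.I * k j) * ∫ x, mFourier (-k) x * ((θ x * v j x : ℝ) : ℂ) ∂μ) :=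
    fun j => (hasSum_coeff_mul (v j) θ k).mul_left _
  convert (hs 0).add (hs 1) using 1
  · funext p
    rw [(h.coeff_eq p).1, (h.coeff_eq p).2]
    simp only [symb, cross, Pi.sub_apply]
    push_cast
    linear_combination (2 * Real.pi * (p 0 * k 1 - p 1 * k 0) / len p * coeff θ p *
      coeff θ (k - p)) * Complex.I_sq
  · have hi : ∀ j, Integrable (fun x => θ x * v j x) μ := fun j => integrable_mul_coeFn _ _
    have hc : ∀ (j : Fin 2) (c : ℝ) (g : Torus → ℝ),
        ∫ x, θ x * v j x * (c * g x) ∂μ = c * ∫ x, θ x * v j x * g x ∂μ := by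
      intro j c g
      rw [← integral_const_mul]
      exact integral_congr_ae (.of_forall fun x => by ring)
    simp only [negDiv, partialDeriv_re_mFourier, partialDeriv_im_mFourier, hc,
      integral_mul_re_mFourier (hi _), integral_mul_im_mFourier (hi _), Fin.sum_univ_two]
    apply Complex.ext
    · simp
    · simp

theorem helmholtz_re_mFourier (a : ℝ) (θ : L2) (k : Fin 2 → ℤ) :
    helmholtz a θ (fun x => (mFourier (-k) x).re) =
      (1 + a ^ 2 * (4 * Real.pi ^ 2 * normSq k)) * (coeff θ k).re := by
  rw [← integral_mul_re_eq_coeff, ← integral_const_mul, helmholtz]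
  refine integral_congr_ae (.of_forall fun x => ?_)
  simp only [laplacian_re_mFourier]
  ring

theorem helmholtz_im_mFourier (a : ℝ) (θ : L2) (k : Fin 2 → ℤ) :
    helmholtz a θ (fun x => (mFourier (-k) x).im) =
      (1 + a ^ 2 * (4 * Real.pi ^ 2 * normSq k)) * (coeff θ k).im := by
  rw [← integral_mul_im_eq_coeff, ← integral_const_mul, helmholtz]
  refine integral_congr_ae (.of_forall fun x => ?_)
  simp only [laplacian_im_mFourier]
  ring

theorem hasDerivWithinAt_coeff {I : Set ℝ} {θ : ℝ → L2}
    (hθ : ContDiffOn ℝ 1 θ I) {t : ℝ} (ht : t ∈ I) (k : Fin 2 → ℤ) :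
    HasDerivWithinAt (fun s => coeff (θ s) k) (coeff (derivWithin θ I t) k) I t := by
  have h := (hθ.differentiableOn (by norm_num) t ht).hasDerivWithinAt
  simpa only [coeffCLM_apply, Function.comp_def] using
    (coeffCLM k).hasFDerivAt.comp_hasDerivWithinAt t h

/-- Tested with e_{-k}, the Helmholtz operator is multiplication by a scalar, so uniqueness of
derivatives turns the distributional equation into one ODE per frequency. The value a = 0 covers the
SQG equation itself. -/
theorem hasSum_coeff_derivWithin_helmholtz {I : Set ℝ} (hI : UniqueDiffOn ℝ I) {θ : ℝ → L2}
    (hθ : ContDiffOn ℝ 1 θ I) {t : ℝ} (ht : t ∈ I) (a : ℝ) {v : Fin 2 → L2}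
    (hv : IsVelocity (θ t) v)
    (heq : ∀ φ, IsTest φ → HasDerivWithinAt (fun s => helmholtz a (θ s) φ)
      (negDiv v (θ t) φ) I t) (k : Fin 2 → ℤ) :
    HasSum (fun p => (symb p (k - p) : ℂ) * coeff (θ t) p * coeff (θ t) (k - p))
      (((1 + a ^ 2 * (4 * Real.pi ^ 2 * normSq k) : ℝ) : ℂ) * coeff (derivWithin θ I t) k) := by
  have h := hasDerivWithinAt_coeff hθ ht k
  have hre := (Complex.reCLM.hasFDerivAt.comp_hasDerivWithinAt t h).const_mul
    (1 + a ^ 2 * (4 * Real.pi ^ 2 * normSq k))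
  have him := (Complex.imCLM.hasFDerivAt.comp_hasDerivWithinAt t h).const_mul
    (1 + a ^ 2 * (4 * Real.pi ^ 2 * normSq k))
  have h1 := heq _ (isTest_re_mFourier (-k))
  have h2 := heq _ (isTest_im_mFourier (-k))
  simp only [helmholtz_re_mFourier] at h1
  simp only [helmholtz_im_mFourier] at h2
  have e1 := (hI t ht).eq_deriv _ h1 hre
  have e2 := (hI t ht).eq_deriv _ h2 him
  convert hasSum_negDiv hv k using 1
  rw [e1, e2]
  generalize 1 + a ^ 2 * (4 * Real.pi ^ 2 * normSq k) = c
  apply Complex.ext <;> simp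

theorem helmholtz_zero (θ : L2) (φ : Torus → ℝ) : helmholtz 0 θ φ = ∫ x, θ x * φ x ∂μ := by
  simp [helmholtz]

/-! ### Wave vectors -/

theorem normSq_nonneg (k : Fin 2 → ℤ) : 0 ≤ normSq k := by
  unfold normSq
  positivity

theorem len_nonneg (k : Fin 2 → ℤ) : 0 ≤ len k := Real.sqrt_nonneg _

theorem len_sq (k : Fin 2 → ℤ) : len k ^ 2 = normSq k := Real.sq_sqrt (normSq_nonneg k)

theorem len_eq_norm (k : Fin 2 → ℤ) : len k = ‖(⟨k 0, k 1⟩ : ℂ)‖ := by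
  rw [len, Complex.norm_eq_sqrt_sq_add_sq]
  rfl

theorem len_neg (k : Fin 2 → ℤ) : len (-k) = len k := by
  simp [len, normSq]

theorem len_add_le (p q : Fin 2 → ℤ) : len (p + q) ≤ len p + len q := by
  simp only [len_eq_norm]
  refine le_trans (le_of_eq ?_) (norm_add_le _ _)
  congr 1
  apply Complex.ext <;> simp

theorem len_le_add (p q : Fin 2 → ℤ) : len p ≤ len (p + q) + len q := by
  have h := len_add_le (p + q) (-q)
  rwa [add_neg_cancel_right, len_neg] at h

theorem len_le_add' (p q : Fin 2 → ℤ) : len q ≤ len (p + q) + len p := by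
  rw [add_comm p q]
  exact len_le_add q p

theorem eq_zero_or_one_le_len (k : Fin 2 → ℤ) : k = 0 ∨ 1 ≤ len k := by
  by_cases h : k = 0
  · exact .inl h
  · right
    rw [len, Real.one_le_sqrt]
    have h1 : ¬(k 0 = 0 ∧ k 1 = 0) := fun ⟨h0, h1⟩ => h (by funext i; fin_cases i <;> assumption)
    have h2 : 1 ≤ k 0 ^ 2 + k 1 ^ 2 := by
      by_contra! hlt
      exact h1 ⟨by nlinarith [sq_nonneg (k 0), sq_nonneg (k 1)],
        by nlinarith [sq_nonneg (k 0), sq_nonneg (k 1)]⟩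
    unfold normSq
    exact_mod_cast h2

theorem len_zero : len 0 = 0 := by simp [len, normSq]

theorem abs_le_len (k : Fin 2 → ℤ) (i : Fin 2) : |(k i : ℝ)| ≤ len k := by
  rw [len]
  apply Real.abs_le_sqrt
  unfold normSq
  fin_cases i
  · exact le_add_of_nonneg_right (sq_nonneg _)
  · exact le_add_of_nonneg_left (sq_nonneg _)

/-! ### A trilinear estimate for square-summable families on the lattice -/

open Classical in
/-- The reciprocal length of `y`, cut off to those `y` whose length is comparable to that of `x`. -/
def comparableInv (x y : Fin 2 → ℤ) : ℝ :=
  if len x ≤ 2 * len y ∧ len y ≤ 2 * len x then (len y)⁻¹ else 0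

theorem comparableInv_nonneg (x y : Fin 2 → ℤ) : 0 ≤ comparableInv x y := by
  unfold comparableInv
  split_ifs
  · exact inv_nonneg.2 (len_nonneg y)
  · exact le_rfl

theorem comparableInv_sq_le (x y : Fin 2 → ℤ) : comparableInv x y ^ 2 ≤ 4 / len x ^ 2 := by
  unfold comparableInv
  split_ifs with h
  · rcases (len_nonneg x).eq_or_lt with hx | hx
    · have : len y = 0 := le_antisymm (by linarith [h.2]) (len_nonneg y)
      simp [this, ← hx]
    · have hy : 0 < len y := by linarith [h.1]
      rw [inv_pow, ← one_div, div_le_div_iff₀ (by positivity) (by positivity)]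
      nlinarith [h.1]
  · simpa using by positivity

/-- In dimension two the sum of |y|⁻² over a dyadic shell is bounded independently of its radius.
The shell lies in a box of at most (4|x| + 1)² ≤ 25|x|² points when |x| ≥ 1, and each term is at
most 4/|x|², hence 100. -/
theorem comparableInv_sq_summable_tsum_le (x : Fin 2 → ℤ) :
    (Summable fun y => comparableInv x y ^ 2) ∧ ∑' y, comparableInv x y ^ 2 ≤ 10 ^ 2 := by
  set n : ℕ := ⌊2 * len x⌋₊ with hn
  set s : Finset (Fin 2 → ℤ) := Fintype.piFinset fun _ => Finset.Icc (-(n : ℤ)) n with hs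
  have hsupp : ∀ y ∉ s, comparableInv x y ^ 2 = 0 := by
    intro y hy
    unfold comparableInv
    split_ifs with h
    · exfalso
      apply hy
      rw [hs, Fintype.mem_piFinset]
      intro i
      rw [Finset.mem_Icc, ← abs_le, Int.abs_eq_natAbs, Nat.cast_le, hn]
      apply Nat.le_floor
      have : ((y i).natAbs : ℝ) = |(y i : ℝ)| := by rw [Nat.cast_natAbs, Int.cast_abs]
      rw [this]
      exact (abs_le_len y i).trans h.2
    · simp
  refine ⟨summable_of_ne_finset_zero hsupp, ?_⟩
  rw [tsum_eq_sum hsupp]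
  have hcard : (s.card : ℝ) = (2 * n + 1) ^ 2 := by
    rw [hs, Fintype.card_piFinset_const, Int.card_Icc]
    have : ((n : ℤ) + 1 - -(n : ℤ)).toNat = 2 * n + 1 := by omega
    rw [this]
    push_cast
    rfl
  refine (Finset.sum_le_card_nsmul s _ _ fun y _ => comparableInv_sq_le x y).trans ?_
  rw [nsmul_eq_mul, hcard]
  rcases eq_zero_or_one_le_len x with h0 | h1
  · rw [h0, len_zero]
    norm_num
  · have hfl : (n : ℝ) ≤ 2 * len x := Nat.floor_le (by linarith)
    rw [mul_div_assoc', div_le_iff₀ (by positivity)]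
    nlinarith [(Nat.cast_nonneg n : (0 : ℝ) ≤ n)]

theorem summable_tsum_mul_le_sqrt {ι : Type*} {F G : ι → ℝ} (hF0 : ∀ i, 0 ≤ F i)
    (hG0 : ∀ i, 0 ≤ G i) (hF : Summable fun i => F i ^ 2) (hG : Summable fun i => G i ^ 2) :
    (Summable fun i => F i * G i) ∧
      ∑' i, F i * G i ≤ √(∑' i, F i ^ 2) * √(∑' i, G i ^ 2) := by
  have hfin : ∀ s : Finset ι, ∑ i ∈ s, F i * G i ≤ √(∑' i, F i ^ 2) * √(∑' i, G i ^ 2) := by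
    intro s
    refine (Real.sum_mul_le_sqrt_mul_sqrt s F G).trans ?_
    gcongr
    · exact hF.sum_le_tsum s fun i _ => sq_nonneg _
    · exact hG.sum_le_tsum s fun i _ => sq_nonneg _
  have h0 : ∀ i, 0 ≤ F i * G i := fun i => mul_nonneg (hF0 i) (hG0 i)
  exact ⟨summable_of_sum_le h0 hfin, Real.tsum_le_of_sum_le h0 hfin⟩

theorem summable_mul_comparableInv_sq {a : (Fin 2 → ℤ) → ℝ} (ha : Summable fun k => a k ^ 2) :
    (Summable fun z : (Fin 2 → ℤ) × (Fin 2 → ℤ) => (a z.1 * comparableInv z.1 z.2) ^ 2) ∧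
      ∑' z : (Fin 2 → ℤ) × (Fin 2 → ℤ), (a z.1 * comparableInv z.1 z.2) ^ 2 ≤
        10 ^ 2 * ∑' k, a k ^ 2 := by
  have hrow : ∀ x, ∑' y, (a x * comparableInv x y) ^ 2 ≤ 10 ^ 2 * a x ^ 2 := by
    intro x
    simp only [mul_pow, tsum_mul_left]
    nlinarith [(comparableInv_sq_summable_tsum_le x).2, sq_nonneg (a x)]
  have hrs : Summable fun x => ∑' y, (a x * comparableInv x y) ^ 2 :=
    Summable.of_nonneg_of_le (fun x => tsum_nonneg fun y => sq_nonneg _) hrow (ha.mul_left _)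
  have hs : Summable fun z : (Fin 2 → ℤ) × (Fin 2 → ℤ) =>
      (a z.1 * comparableInv z.1 z.2) ^ 2 := by
    refine (summable_prod_of_nonneg fun z => sq_nonneg _).2 ⟨fun x => ?_, hrs⟩
    simp only [mul_pow]
    exact (comparableInv_sq_summable_tsum_le x).1.mul_left _
  refine ⟨hs, ?_⟩
  rw [hs.tsum_prod, ← tsum_mul_left]
  exact hrs.tsum_le_tsum hrow (ha.mul_left _)

theorem summable_mul_sq {a b : (Fin 2 → ℤ) → ℝ} (ha : Summable fun k => a k ^ 2)
    (hb : Summable fun k => b k ^ 2) :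
    (Summable fun z : (Fin 2 → ℤ) × (Fin 2 → ℤ) => (a z.1 * b z.2) ^ 2) ∧
      ∑' z : (Fin 2 → ℤ) × (Fin 2 → ℤ), (a z.1 * b z.2) ^ 2 =
        (∑' k, a k ^ 2) * ∑' k, b k ^ 2 := by
  have hs : Summable fun z : (Fin 2 → ℤ) × (Fin 2 → ℤ) => a z.1 ^ 2 * b z.2 ^ 2 :=
    ha.mul_of_nonneg hb (fun _ => sq_nonneg _) fun _ => sq_nonneg _
  simp only [mul_pow]
  exact ⟨hs, (ha.tsum_mul_tsum hb hs).symm⟩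

/-- The ℓ² norm of a family of real numbers. -/
def ell2 {ι : Type*} (a : ι → ℝ) : ℝ := √(∑' k, a k ^ 2)

theorem ell2_nonneg {ι : Type*} (a : ι → ℝ) : 0 ≤ ell2 a := Real.sqrt_nonneg _

/-- Cauchy–Schwarz for `∑ a(x) h(x, y) b(x') c(y')` over two parametrizations of pairs. -/
theorem summable_tsum_comparableInv_le {a b c : (Fin 2 → ℤ) → ℝ} (ha0 : ∀ k, 0 ≤ a k)
    (hb0 : ∀ k, 0 ≤ b k) (hc0 : ∀ k, 0 ≤ c k) (ha : Summable fun k => a k ^ 2)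
    (hb : Summable fun k => b k ^ 2) (hc : Summable fun k => c k ^ 2)
    (e e' : (Fin 2 → ℤ) × (Fin 2 → ℤ) ≃ (Fin 2 → ℤ) × (Fin 2 → ℤ)) :
    (Summable fun z => a (e z).1 * comparableInv (e z).1 (e z).2 * (b (e' z).1 * c (e' z).2)) ∧
      ∑' z, a (e z).1 * comparableInv (e z).1 (e z).2 * (b (e' z).1 * c (e' z).2) ≤
        10 * ell2 a * ell2 b * ell2 c := by
  have h1 := summable_mul_comparableInv_sq ha
  have h2 := summable_mul_sq hb hc
  have h := summable_tsum_mul_le_sqrt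
    (F := fun z => a (e z).1 * comparableInv (e z).1 (e z).2)
    (G := fun z => b (e' z).1 * c (e' z).2)
    (fun z => mul_nonneg (ha0 _) (comparableInv_nonneg _ _))
    (fun z => mul_nonneg (hb0 _) (hc0 _))
    (e.summable_iff.2 h1.1) (e'.summable_iff.2 h2.1)
  refine ⟨h.1, h.2.trans ?_⟩
  have e1 := e.tsum_eq fun z => (a z.1 * comparableInv z.1 z.2) ^ 2
  have e2 := e'.tsum_eq fun z => (b z.1 * c z.2) ^ 2
  rw [e1, e2, h2.2, Real.sqrt_mul (tsum_nonneg fun _ => sq_nonneg _), ← mul_assoc]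
  have h3 : √(∑' z : (Fin 2 → ℤ) × (Fin 2 → ℤ), (a z.1 * comparableInv z.1 z.2) ^ 2) ≤
      10 * ell2 a := by
    refine (Real.sqrt_le_sqrt h1.2).trans (le_of_eq ?_)
    rw [Real.sqrt_mul (by positivity), Real.sqrt_sq (by norm_num)]
    rfl
  exact mul_le_mul_of_nonneg_right (mul_le_mul_of_nonneg_right h3 (ell2_nonneg b)) (ell2_nonneg c)

/-- The change of variables `(p, q) ↦ (p, p + q)`. -/
def shearFst : (Fin 2 → ℤ) × (Fin 2 → ℤ) ≃ (Fin 2 → ℤ) × (Fin 2 → ℤ) where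
  toFun z := (z.1, z.1 + z.2)
  invFun z := (z.1, z.2 - z.1)
  left_inv z := by simp
  right_inv z := by simp

/-- If p and p + q are not comparable in length, the triangle inequality makes q comparable to the
longer of them. Each case is one of the three summands. -/
theorem inv_max_le (p q : Fin 2 → ℤ) :
    (max (len p) (len (p + q)))⁻¹ ≤
      comparableInv p (p + q) + comparableInv q (p + q) + comparableInv q p := by
  have h1 := len_add_le p q
  have h2 := len_le_add p q
  have h3 := len_le_add' p q
  have n1 := comparableInv_nonneg p (p + q)
  have n2 := comparableInv_nonneg q (p + q)
  have n3 := comparableInv_nonneg q p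
  rcases le_total (len p) (len (p + q)) with h | h
  · rw [max_eq_right h]
    by_cases hp : len (p + q) ≤ 2 * len p
    · have : comparableInv p (p + q) = (len (p + q))⁻¹ :=
        if_pos ⟨by linarith [len_nonneg p], hp⟩
      linarith
    · have : comparableInv q (p + q) = (len (p + q))⁻¹ :=
        if_pos ⟨by linarith, by linarith⟩
      linarith
  · rw [max_eq_left h]
    by_cases hp : len p ≤ 2 * len (p + q)
    · have h4 : comparableInv p (p + q) = (len (p + q))⁻¹ :=
        if_pos ⟨hp, by linarith [len_nonneg p]⟩
      have h5 : (len p)⁻¹ ≤ (len (p + q))⁻¹ := by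
        rcases (len_nonneg (p + q)).eq_or_lt with h0 | h0
        · have : len p = 0 := le_antisymm (by linarith) (len_nonneg p)
          rw [this, ← h0]
        · exact inv_anti₀ h0 h
      linarith
    · have : comparableInv q p = (len p)⁻¹ := if_pos ⟨by linarith, by linarith⟩
      linarith

/-- The trilinear estimate `∑ a(p) b(q) c(p + q) / max(|p|, |p + q|) ≤ 30 ‖a‖ ‖b‖ ‖c‖`. -/
theorem summable_tsum_div_max_le {a b c : (Fin 2 → ℤ) → ℝ} (ha0 : ∀ k, 0 ≤ a k)
    (hb0 : ∀ k, 0 ≤ b k) (hc0 : ∀ k, 0 ≤ c k) (ha : Summable fun k => a k ^ 2)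
    (hb : Summable fun k => b k ^ 2) (hc : Summable fun k => c k ^ 2) :
    (Summable fun z : (Fin 2 → ℤ) × (Fin 2 → ℤ) =>
      a z.1 * b z.2 * c (z.1 + z.2) * (max (len z.1) (len (z.1 + z.2)))⁻¹) ∧
      ∑' z : (Fin 2 → ℤ) × (Fin 2 → ℤ),
        a z.1 * b z.2 * c (z.1 + z.2) * (max (len z.1) (len (z.1 + z.2)))⁻¹ ≤
        30 * ell2 a * ell2 b * ell2 c := by
  let sw : (Fin 2 → ℤ) × (Fin 2 → ℤ) ≃ (Fin 2 → ℤ) × (Fin 2 → ℤ) := Equiv.prodComm _ _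
  -- One Cauchy–Schwarz per summand of `inv_max_le`: the factor sharing its first frequency takes
  -- the weight, the other two form a product over independent frequencies.
  have h1 := summable_tsum_comparableInv_le ha0 hb0 hc0 ha hb hc shearFst (sw.trans shearFst)
  have h2 := summable_tsum_comparableInv_le hb0 ha0 hc0 hb ha hc (sw.trans shearFst) shearFst
  have h3 := summable_tsum_comparableInv_le hb0 ha0 hc0 hb ha hc sw shearFst
  have hs := (h1.1.add h2.1).add h3.1
  have h0 : ∀ z : (Fin 2 → ℤ) × (Fin 2 → ℤ),
      0 ≤ a z.1 * b z.2 * c (z.1 + z.2) * (max (len z.1) (len (z.1 + z.2)))⁻¹ := fun z =>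
    mul_nonneg (mul_nonneg (mul_nonneg (ha0 _) (hb0 _)) (hc0 _))
      (inv_nonneg.2 (le_max_of_le_left (len_nonneg _)))
  have hle : ∀ z : (Fin 2 → ℤ) × (Fin 2 → ℤ),
      a z.1 * b z.2 * c (z.1 + z.2) * (max (len z.1) (len (z.1 + z.2)))⁻¹ ≤
        a (shearFst z).1 * comparableInv (shearFst z).1 (shearFst z).2 *
          (b ((sw.trans shearFst) z).1 * c ((sw.trans shearFst) z).2) +
        b ((sw.trans shearFst) z).1 *
          comparableInv ((sw.trans shearFst) z).1 ((sw.trans shearFst) z).2 *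
          (a (shearFst z).1 * c (shearFst z).2) +
        b (sw z).1 * comparableInv (sw z).1 (sw z).2 * (a (shearFst z).1 * c (shearFst z).2) := by
    intro z
    refine (mul_le_mul_of_nonneg_left (inv_max_le z.1 z.2)
      (mul_nonneg (mul_nonneg (ha0 _) (hb0 _)) (hc0 _))).trans (le_of_eq ?_)
    simp only [shearFst, sw, Equiv.trans_apply, Equiv.coe_fn_mk, Equiv.prodComm_apply,
      Prod.fst_swap, Prod.snd_swap, add_comm z.2 z.1]
    ring
  have hsum := Summable.of_nonneg_of_le h0 hle hs
  refine ⟨hsum, (hsum.tsum_le_tsum hle hs).trans ?_⟩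
  rw [(h1.1.add h2.1).tsum_add h3.1, h1.1.tsum_add h2.1]
  calc _ ≤ 10 * ell2 a * ell2 b * ell2 c + 10 * ell2 b * ell2 a * ell2 c +
        10 * ell2 b * ell2 a * ell2 c := add_le_add (add_le_add h1.2 h2.2) h3.2
    _ = _ := by ring

/-! ### Cancellations in the quadratic term -/

theorem abs_cross_le (p q : Fin 2 → ℤ) : |cross p q| ≤ len p * len q := by
  rw [len, len, ← Real.sqrt_mul (normSq_nonneg p)]
  apply Real.abs_le_sqrt
  unfold cross normSq
  nlinarith [sq_nonneg ((p 0 : ℝ) * q 0 + p 1 * q 1)]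

theorem cross_add_right (p q : Fin 2 → ℤ) : cross p (p + q) = cross p q := by
  simp only [cross, Pi.add_apply]
  push_cast
  ring

theorem cross_add_left (p q : Fin 2 → ℤ) : cross (p + q) q = cross p q := by
  simp only [cross, Pi.add_apply]
  push_cast
  ring

theorem cross_neg_left (p q : Fin 2 → ℤ) : cross (-p) q = -cross p q := by
  simp only [cross, Pi.neg_apply]
  push_cast
  ring

theorem cross_neg_right (p q : Fin 2 → ℤ) : cross p (-q) = -cross p q := by
  simp only [cross, Pi.neg_apply]
  push_cast
  ring

theorem symb_neg_add_right (p q : Fin 2 → ℤ) : symb p (-(p + q)) = -symb p q := by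
  rw [symb, symb, cross_neg_right, cross_add_right]
  ring

theorem symb_neg_add_left (p q : Fin 2 → ℤ) :
    symb (-(p + q)) q = -(2 * Real.pi * (cross p q / len (p + q))) := by
  rw [symb, cross_neg_left, cross_add_left, len_neg]
  ring

/-- Since p × q = p × (p + q), the derivative can be placed on either the transported function or
the test function. -/
theorem abs_symb_le (p q : Fin 2 → ℤ) : |symb p q| ≤ 2 * Real.pi * min (len q) (len (p + q)) := by
  rw [symb, abs_mul, abs_of_pos Real.two_pi_pos, abs_div, abs_of_nonneg (len_nonneg p)]
  refine mul_le_mul_of_nonneg_left ?_ Real.two_pi_pos.le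
  refine le_min ?_ ?_
  · exact div_le_of_le_mul₀ (len_nonneg p) (len_nonneg q) (by
      rw [mul_comm]; exact abs_cross_le p q)
  · refine div_le_of_le_mul₀ (len_nonneg p) (len_nonneg _) ?_
    rw [← cross_add_right, mul_comm]
    exact abs_cross_le _ _

theorem min_eq_mul_mul_inv_max {x y : ℝ} (hx : 0 ≤ x) (hy : 0 ≤ y) :
    min x y = x * y * (max x y)⁻¹ := by
  rcases hx.eq_or_lt with h | h
  · simp [← h, hy]
  · have : max x y ≠ 0 := (lt_max_of_lt_left h).ne'
    rw [eq_mul_inv_iff_mul_eq₀ this, min_mul_max]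

/-- Fourier coefficients of a function in `Ḣ¹`. -/
structure IsDotH1Family (f : (Fin 2 → ℤ) → ℂ) : Prop where
  zero : f 0 = 0
  summable : Summable fun k => (len k * ‖f k‖) ^ 2

/-- The summands of the trilinear form `∫ (-div (v θ)) w` in Fourier variables. -/
def triTerm (f g h : (Fin 2 → ℤ) → ℂ) (z : (Fin 2 → ℤ) × (Fin 2 → ℤ)) : ℂ :=
  conj (h (z.1 + z.2)) * (symb z.1 z.2 * f z.1 * g z.2)

theorem norm_triTerm (f g h : (Fin 2 → ℤ) → ℂ) (z : (Fin 2 → ℤ) × (Fin 2 → ℤ)) :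
    ‖triTerm f g h z‖ = |symb z.1 z.2| * (‖f z.1‖ * ‖g z.2‖ * ‖h (z.1 + z.2)‖) := by
  rw [triTerm, norm_mul, norm_mul, norm_mul, RCLike.norm_conj, Complex.norm_real,
    Real.norm_eq_abs]
  ring

/-- Absolute convergence licenses the later splittings and regroupings. The minimum in `abs_symb_le`
equals |q||p+q| / max(|q|, |p+q|), which is the trilinear weight with p and q exchanged; the weight
|p| on f is free since f vanishes at 0. -/
theorem summable_triTerm {f g h : (Fin 2 → ℤ) → ℂ} (hf : IsDotH1Family f)
    (hg : IsDotH1Family g) (hh : IsDotH1Family h) : Summable (triTerm f g h) := by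
  have hK := (summable_tsum_div_max_le (a := fun k => len k * ‖g k‖)
    (b := fun k => len k * ‖f k‖) (c := fun k => len k * ‖h k‖)
    (fun k => mul_nonneg (len_nonneg k) (norm_nonneg _))
    (fun k => mul_nonneg (len_nonneg k) (norm_nonneg _))
    (fun k => mul_nonneg (len_nonneg k) (norm_nonneg _)) hg.summable hf.summable hh.summable).1
  have hK' := ((Equiv.prodComm (Fin 2 → ℤ) (Fin 2 → ℤ)).summable_iff.2 hK).mul_left (2 * Real.pi)
  refine hK'.of_norm_bounded fun z => ?_
  obtain ⟨p, q⟩ := z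
  rw [norm_triTerm]
  simp only [Function.comp, Equiv.prodComm_apply, Prod.fst_swap, Prod.snd_swap, add_comm q p]
  rcases eq_zero_or_one_le_len p with hp | hp
  · rw [hp, hf.zero]
    simp
  · have h1 := abs_symb_le p q
    rw [min_eq_mul_mul_inv_max (len_nonneg _) (len_nonneg _)] at h1
    have h2 : 0 ≤ ‖f p‖ * ‖g q‖ * ‖h (p + q)‖ := by positivity
    have h3 : 0 ≤ 2 * Real.pi * (len q * len (p + q) * (max (len q) (len (p + q)))⁻¹) :=
      (abs_nonneg _).trans h1
    calc _ ≤ 2 * Real.pi * (len q * len (p + q) * (max (len q) (len (p + q)))⁻¹) *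
          (‖f p‖ * ‖g q‖ * ‖h (p + q)‖) := mul_le_mul_of_nonneg_right h1 h2
      _ ≤ 2 * Real.pi * (len q * len (p + q) * (max (len q) (len (p + q)))⁻¹) *
          (‖f p‖ * ‖g q‖ * ‖h (p + q)‖) * len p :=
        le_mul_of_one_le_right (mul_nonneg h3 h2) hp
      _ = _ := by ring

/-- The involution `(p, q) ↦ (p, -(p + q))`. -/
def flipSnd : (Fin 2 → ℤ) × (Fin 2 → ℤ) ≃ (Fin 2 → ℤ) × (Fin 2 → ℤ) where
  toFun z := (z.1, -(z.1 + z.2))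
  invFun z := (z.1, -(z.1 + z.2))
  left_inv z := by simp
  right_inv z := by simp

/-- The involution `(p, q) ↦ (-(p + q), q)`. -/
def flipFst : (Fin 2 → ℤ) × (Fin 2 → ℤ) ≃ (Fin 2 → ℤ) × (Fin 2 → ℤ) where
  toFun z := (-(z.1 + z.2), z.2)
  invFun z := (-(z.1 + z.2), z.2)
  left_inv z := by simp
  right_inv z := by simp

/-- A divergence-free field transports `w` without changing `∫ w²`. -/
theorem tsum_triTerm_self {f w : (Fin 2 → ℤ) → ℂ} (hw : ∀ k, w (-k) = conj (w k)) :
    ∑' z, triTerm f w w z = 0 := by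
  -- By reality, the involution exchanges the two copies of w, while the symbol changes sign.
  have h : ∀ z, triTerm f w w (flipSnd z) = -triTerm f w w z := by
    rintro ⟨p, q⟩
    simp only [triTerm, flipSnd, Equiv.coe_fn_mk, symb_neg_add_right]
    have h1 : p + -(p + q) = -q := by abel
    rw [h1, hw q, hw (p + q), Complex.conj_conj]
    push_cast
    ring
  have h1 := flipSnd.tsum_eq (triTerm f w w)
  simp only [h, tsum_neg] at h1
  exact self_eq_neg.1 h1.symm

/-- The difference of reciprocals is at most |q| / (|p||p+q|), and the cross product is at most |q|
min(|p|, |p+q|); the minimum over the product is 1/max. If p or p + q is zero, the cross product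
vanishes. -/
theorem abs_cross_mul_abs_inv_sub_inv_le (p q : Fin 2 → ℤ) :
    |cross p q| * |(len p)⁻¹ - (len (p + q))⁻¹| ≤ len q ^ 2 * (max (len p) (len (p + q)))⁻¹ := by
  have hR : 0 ≤ len q ^ 2 * (max (len p) (len (p + q)))⁻¹ :=
    mul_nonneg (sq_nonneg _) (inv_nonneg.2 (le_max_of_le_left (len_nonneg _)))
  have c1 := abs_cross_le p q
  have c2 := abs_cross_le (p + q) q
  rw [cross_add_left] at c2
  rcases (len_nonneg p).eq_or_lt with hp | hp
  · have : |cross p q| = 0 := le_antisymm (by rw [← hp] at c1; simpa using c1) (abs_nonneg _)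
    rwa [this, zero_mul]
  rcases (len_nonneg (p + q)).eq_or_lt with hr | hr
  · have : |cross p q| = 0 := le_antisymm (by rw [← hr] at c2; simpa using c2) (abs_nonneg _)
    rwa [this, zero_mul]
  have hmin : |cross p q| ≤ min (len p) (len (p + q)) * len q := by
    rcases min_choice (len p) (len (p + q)) with h | h <;> rw [h] <;> assumption
  have hdiff : |(len p)⁻¹ - (len (p + q))⁻¹| ≤ len q * (len p * len (p + q))⁻¹ := by
    rw [inv_sub_inv hp.ne' hr.ne', abs_div, abs_of_pos (mul_pos hp hr), div_eq_mul_inv]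
    refine mul_le_mul_of_nonneg_right ?_ (inv_nonneg.2 (mul_pos hp hr).le)
    rw [abs_le]
    constructor <;> linarith [len_add_le p q, len_le_add p q]
  calc _ ≤ min (len p) (len (p + q)) * len q * (len q * (len p * len (p + q))⁻¹) := by
        gcongr
        exact mul_nonneg (le_min hp.le hr.le) (len_nonneg q)
    _ = _ := by
        rw [min_eq_mul_mul_inv_max hp.le hr.le]
        field_simp

/-- The commutator estimate `|∫ w u·∇g| ≤ C ‖w‖² ‖Δg‖` for `u = ∇^⊥ (-Δ)^{-1/2} w`. -/
theorem norm_tsum_triTerm_le {w g : (Fin 2 → ℤ) → ℂ} (hw : ∀ k, w (-k) = conj (w k))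
    (hw1 : IsDotH1Family w) (hg1 : IsDotH1Family g) (hw2 : Summable fun k => ‖w k‖ ^ 2)
    (hg2 : Summable fun k => (len k ^ 2 * ‖g k‖) ^ 2) :
    ‖∑' z, triTerm w g w z‖ ≤
      30 * Real.pi * ell2 (fun k => len k ^ 2 * ‖g k‖) * ∑' k, ‖w k‖ ^ 2 := by
  have hs := summable_triTerm hw1 hg1 hw1
  have h1 := flipFst.tsum_eq (triTerm w g w)
  have hs' : Summable fun z => triTerm w g w (flipFst z) := flipFst.summable_iff.2 hs
  -- Averaging over the involution that exchanges the two copies of w and fixes q produces the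
  -- commutator. The final 30π is half of 2π · 30.
  have h2 : 2 * ∑' z, triTerm w g w z = ∑' z, (triTerm w g w z + triTerm w g w (flipFst z)) := by
    rw [hs.tsum_add hs', h1, two_mul]
  have hK := summable_tsum_div_max_le (a := fun k => ‖w k‖)
    (b := fun k => len k ^ 2 * ‖g k‖) (c := fun k => ‖w k‖) (fun k => norm_nonneg _)
    (fun k => mul_nonneg (sq_nonneg _) (norm_nonneg _)) (fun k => norm_nonneg _) hw2 hg2 hw2
  have h3 := tsum_of_norm_bounded (f := fun z => triTerm w g w z + triTerm w g w (flipFst z))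
    (hK.1.hasSum.mul_left (2 * Real.pi)) (by
      rintro ⟨p, q⟩
      have he : triTerm w g w (p, q) + triTerm w g w (flipFst (p, q)) =
          ((2 * Real.pi * (cross p q * ((len p)⁻¹ - (len (p + q))⁻¹)) : ℝ) : ℂ) *
            (conj (w (p + q)) * w p * g q) := by
        simp only [triTerm, flipFst, Equiv.coe_fn_mk, symb_neg_add_left]
        have h1 : -(p + q) + q = -p := by abel
        rw [h1, hw p, hw (p + q), Complex.conj_conj, symb]
        push_cast
        ring
      rw [he, norm_mul, norm_mul, norm_mul, RCLike.norm_conj, Complex.norm_real, Real.norm_eq_abs,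
        abs_mul (2 * Real.pi), abs_mul (cross p q), abs_of_pos Real.two_pi_pos]
      have := abs_cross_mul_abs_inv_sub_inv_le p q
      have h5 : 0 ≤ 2 * Real.pi * (‖w (p + q)‖ * ‖w p‖ * ‖g q‖) := by positivity
      have h6 := mul_le_mul_of_nonneg_left this h5
      linarith)
  rw [← h2, norm_mul, Complex.norm_two] at h3
  have h4 : ell2 (fun k => ‖w k‖) * ell2 (fun k => ‖w k‖) = ∑' k, ‖w k‖ ^ 2 :=
    Real.mul_self_sqrt (tsum_nonneg fun _ => sq_nonneg _)
  have h5 := mul_le_mul_of_nonneg_left hK.2 Real.two_pi_pos.le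
  rw [← h4]
  linarith

/-- The change of variables `(k, p) ↦ (p, k - p)`. -/
def frequencySplit : (Fin 2 → ℤ) × (Fin 2 → ℤ) ≃ (Fin 2 → ℤ) × (Fin 2 → ℤ) where
  toFun z := (z.2, z.1 - z.2)
  invFun z := (z.1 + z.2, z.1)
  left_inv z := by simp
  right_inv z := by simp

/-- The difference of two quadratic terms, tested with the difference of the arguments. -/
theorem exists_hasSum_conj_mul_sub {f g F G : (Fin 2 → ℤ) → ℂ} (hf : ∀ k, f (-k) = conj (f k))
    (hg : ∀ k, g (-k) = conj (g k)) (hf1 : IsDotH1Family f) (hg1 : IsDotH1Family g)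
    (hw1 : IsDotH1Family (g - f)) (hw2 : Summable fun k => ‖(g - f) k‖ ^ 2)
    (hg2 : Summable fun k => (len k ^ 2 * ‖g k‖) ^ 2)
    (hF : ∀ k, HasSum (fun p => (symb p (k - p) : ℂ) * f p * f (k - p)) (F k))
    (hG : ∀ k, HasSum (fun p => (symb p (k - p) : ℂ) * g p * g (k - p)) (G k)) :
    ∃ S : ℂ, HasSum (fun k => conj ((g - f) k) * (G k - F k)) S ∧
      ‖S‖ ≤ 30 * Real.pi * ell2 (fun k => len k ^ 2 * ‖g k‖) * ∑' k, ‖(g - f) k‖ ^ 2 := by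
  set w := g - f with hwdef
  have hw : ∀ k, w (-k) = conj (w k) := fun k => by
    simp only [hwdef, Pi.sub_apply, hf, hg, map_sub]
  have h1 := summable_triTerm hf1 hw1 hw1
  have h2 := summable_triTerm hw1 hg1 hw1
  refine ⟨∑' z, triTerm w g w z, ?_, norm_tsum_triTerm_le hw hw1 hg1 hw2 hg2⟩
  -- With q = k - p, the splitting is g_p g_q - f_p f_q = f_p w_q + w_p g_q.
  have hsum := h1.hasSum.add h2.hasSum
  rw [tsum_triTerm_self hw, zero_add] at hsum
  refine HasSum.prod_fiberwise (frequencySplit.hasSum_iff.2 hsum) fun k => ?_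
  refine (((hG k).sub (hF k)).mul_left (conj (w k))).congr_fun fun p => ?_
  simp only [Function.comp, frequencySplit, Equiv.coe_fn_mk, triTerm, add_sub_cancel, hwdef,
    Pi.sub_apply]
  ring

/-! ### Sobolev norms in terms of Fourier coefficients -/

theorem norm_coeff_weakPartial_sq {f : L2} (hf : MemH1 f) (j : Fin 2) (k : Fin 2 → ℤ) :
    ‖coeff (weakPartial j f) k‖ ^ 2 = 4 * Real.pi ^ 2 * (k j : ℝ) ^ 2 * ‖coeff f k‖ ^ 2 := by
  rw [hf.coeff_weakPartial]
  simp only [norm_mul, Complex.norm_ofNat, Complex.norm_real, Complex.norm_I, Real.norm_eq_abs,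
    Complex.norm_intCast, mul_pow, sq_abs]
  ring

theorem MemH1.hasSum_len {f : L2} (hf : MemH1 f) :
    HasSum (fun k => (2 * Real.pi) ^ 2 * (len k * ‖coeff f k‖) ^ 2) (gradNormSq f) := by
  have h := hasSum_sum (s := Finset.univ) fun j _ => hasSum_norm_coeff_sq (weakPartial j f)
  refine h.congr_fun fun k => ?_
  rw [mul_pow (len k), len_sq, normSq, Fin.sum_univ_two, norm_coeff_weakPartial_sq hf,
    norm_coeff_weakPartial_sq hf]
  ring

theorem MemH1.isDotH1Family {f : L2} (hf : MemH1 f) (h0 : MeanZero f) :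
    IsDotH1Family (coeff f) :=
  ⟨h0.coeff_zero, (summable_mul_left_iff (by positivity)).1 hf.hasSum_len.summable⟩

theorem MemH2.hasSum_len_sq {f : L2} (hf : MemH2 f) :
    HasSum (fun k => (2 * Real.pi) ^ 4 * (len k ^ 2 * ‖coeff f k‖) ^ 2)
      (∑ j, gradNormSq (weakPartial j f)) := by
  have h := hasSum_sum (s := Finset.univ) fun j _ => (hf.2 j).hasSum_len
  refine h.congr_fun fun k => ?_
  simp only [mul_pow, Fin.sum_univ_two, norm_coeff_weakPartial_sq hf.1]
  have : len k ^ 2 = (k 0 : ℝ) ^ 2 + (k 1 : ℝ) ^ 2 := len_sq k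
  rw [this]
  ring

theorem MemH2.summable_len_sq {f : L2} (hf : MemH2 f) :
    Summable fun k => (len k ^ 2 * ‖coeff f k‖) ^ 2 :=
  (summable_mul_left_iff (by positivity)).1 hf.hasSum_len_sq.summable

theorem MemH2.ell2_len_sq_le {f : L2} (hf : MemH2 f) :
    ell2 (fun k => len k ^ 2 * ‖coeff f k‖) ≤ √(∑ j, gradNormSq (weakPartial j f)) := by
  refine Real.sqrt_le_sqrt ?_
  rw [← hf.hasSum_len_sq.tsum_eq]
  refine hf.summable_len_sq.tsum_le_tsum (fun k => ?_) hf.hasSum_len_sq.summable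
  refine le_mul_of_one_le_left (sq_nonneg _) (one_le_pow₀ ?_)
  linarith [Real.pi_gt_three]

/-! ### The energy identity -/

/-- Time and weak space derivatives commute, as seen on each Fourier coefficient. -/
theorem IsC1H1.coeff_derivWithin_weakPartial {I : Set ℝ} (hI : UniqueDiffOn ℝ I) {θ : ℝ → L2}
    (hθ : IsC1H1 I θ) {t : ℝ} (ht : t ∈ I) (j : Fin 2) (k : Fin 2 → ℤ) :
    coeff (derivWithin (fun s => weakPartial j (θ s)) I t) k =
      2 * Real.pi * Complex.I * k j * coeff (derivWithin θ I t) k := by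
  have h1 := hasDerivWithinAt_coeff (hθ.contDiffOn_weakPartial j) ht k
  have h2 := (hasDerivWithinAt_coeff hθ.contDiffOn ht k).const_mul
    (2 * Real.pi * Complex.I * k j : ℂ)
  refine (hI t ht).eq_deriv _ h1 (h2.congr (fun s hs => ?_) ?_)
  · exact (hθ.memH1 s hs).coeff_weakPartial j k
  · exact (hθ.memH1 t ht).coeff_weakPartial j k

/-- Parseval form of pairing (1 - a²Δ)∂ₜ(η - θ) with η - θ. The equation for η has no Helmholtz
term, so a²⟨∇w, ∇∂ₜη⟩ is left over as the forcing. -/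
theorem energy_balance {I : Set ℝ} (hI : UniqueDiffOn ℝ I) {θ η : ℝ → L2} (hθ : IsC1H1 I θ)
    (hη : IsC1H1 I η) {t : ℝ} (ht : t ∈ I) (a : ℝ) {S : ℂ}
    (hS : HasSum (fun k => conj (coeff (η t - θ t) k) * (coeff (derivWithin η I t) k -
      ((1 + a ^ 2 * (4 * Real.pi ^ 2 * normSq k) : ℝ) : ℂ) * coeff (derivWithin θ I t) k)) S) :
    inner ℝ (η t - θ t) (derivWithin η I t - derivWithin θ I t) +
      a ^ 2 * ∑ j, inner ℝ (weakPartial j (η t - θ t))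
        (derivWithin (fun s => weakPartial j (η s)) I t -
          derivWithin (fun s => weakPartial j (θ s)) I t) =
    S.re + a ^ 2 * ∑ j, inner ℝ (weakPartial j (η t - θ t))
        (derivWithin (fun s => weakPartial j (η s)) I t) := by
  have hw := (hη.memH1 t ht).sub (hθ.memH1 t ht)
  have h1 := hasSum_conj_coeff_mul (η t - θ t) (derivWithin η I t - derivWithin θ I t)
  have h2 := fun j => hasSum_conj_coeff_mul (weakPartial j (η t - θ t))
    (derivWithin (fun s => weakPartial j (η s)) I t -
      derivWithin (fun s => weakPartial j (θ s)) I t)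
  have h3 := fun j => hasSum_conj_coeff_mul (weakPartial j (η t - θ t))
    (derivWithin (fun s => weakPartial j (η s)) I t)
  have hl := h1.add (((h2 0).add (h2 1)).mul_left ((a : ℂ) ^ 2))
  have hr := hS.add (((h3 0).add (h3 1)).mul_left ((a : ℂ) ^ 2))
  have he := hl.unique (hr.congr_fun fun k => by
    simp only [coeff_sub _ (derivWithin _ _ _), hw.coeff_weakPartial,
      hη.coeff_derivWithin_weakPartial hI ht, hθ.coeff_derivWithin_weakPartial hI ht,
      map_mul, Complex.conj_ofReal, Complex.conj_I, map_ofNat, map_intCast, normSq]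
    push_cast
    linear_combination (4 * Real.pi ^ 2 * (a : ℂ) ^ 2 * conj (coeff (η t - θ t) k) *
      coeff (derivWithin θ I t) k * ((k 0 : ℂ) ^ 2 + (k 1 : ℂ) ^ 2)) * Complex.I_sq)
  have := congrArg Complex.re he
  rw [Fin.sum_univ_two, Fin.sum_univ_two]
  have hre : ∀ x y z : ℝ, ((x : ℂ) + (a : ℂ) ^ 2 * ((y : ℂ) + (z : ℂ))).re =
      x + a ^ 2 * (y + z) := by
    intro x y z
    norm_cast
  have hre' : ∀ y z : ℝ, (S + (a : ℂ) ^ 2 * ((y : ℂ) + (z : ℂ))).re =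
      S.re + a ^ 2 * (y + z) := by
    intro y z
    rw [Complex.add_re]
    norm_cast
  rwa [hre, hre'] at this

/-- The energy whose convergence to zero is to be shown. -/
def energy (a : ℝ) (f : L2) : ℝ := ‖f‖ ^ 2 + a ^ 2 * gradNormSq f

theorem gradNormSq_nonneg (f : L2) : 0 ≤ gradNormSq f := Finset.sum_nonneg fun _ _ => sq_nonneg _

theorem energy_nonneg (a : ℝ) (f : L2) : 0 ≤ energy a f :=
  add_nonneg (sq_nonneg _) (mul_nonneg (sq_nonneg _) (gradNormSq_nonneg f))

theorem hasDerivWithinAt_energy {I : Set ℝ} {θ η : ℝ → L2} (hθ : IsC1H1 I θ)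
    (hη : IsC1H1 I η) {t : ℝ} (ht : t ∈ I) (a : ℝ) :
    HasDerivWithinAt (fun s => energy a (η s - θ s))
      (2 * (inner ℝ (η t - θ t) (derivWithin η I t - derivWithin θ I t) +
      a ^ 2 * ∑ j, inner ℝ (weakPartial j (η t - θ t))
        (derivWithin (fun s => weakPartial j (η s)) I t -
          derivWithin (fun s => weakPartial j (θ s)) I t))) I t := by
  have hd : ∀ {ζ : ℝ → L2}, ContDiffOn ℝ 1 ζ I → HasDerivWithinAt ζ (derivWithin ζ I t) I t :=
    fun h => (h.differentiableOn (by norm_num) t ht).hasDerivWithinAt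
  have hw : ∀ s ∈ I, ∀ j, weakPartial j (η s - θ s) = weakPartial j (η s) - weakPartial j (θ s) :=
    fun s hs j => (hη.memH1 s hs).weakPartial_sub (hθ.memH1 s hs) j
  have h0 := ((hd hη.contDiffOn).sub (hd hθ.contDiffOn)).norm_sq
  have hj := fun j =>
    ((hd (hη.contDiffOn_weakPartial j)).sub (hd (hθ.contDiffOn_weakPartial j))).norm_sq
  have h := h0.add (((hj 0).add (hj 1)).const_mul (a ^ 2))
  refine HasDerivWithinAt.congr_deriv (h.congr (fun s hs => ?_) ?_) ?_
  · simp only [energy, gradNormSq, Fin.sum_univ_two, hw s hs]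
    rfl
  · simp only [energy, gradNormSq, Fin.sum_univ_two, hw t ht]
    rfl
  · simp only [Fin.sum_univ_two, hw t ht, Pi.sub_apply]
    ring

/-- The commutator estimate contributes 2 · 30π M‖w‖². Young's inequality on the forcing gives
a²‖∇w‖², absorbed by the + 1 in the rate, and a²N. -/
theorem abs_energy_deriv_le {I : Set ℝ} (hI : UniqueDiffOn ℝ I) {θ η : ℝ → L2}
    (hθ : IsC1H1 I θ) (hη : IsC1H1 I η) {t : ℝ} (ht : t ∈ I) (hη2 : MemH2 (η t)) (a : ℝ)
    {v u : Fin 2 → L2} (hv : IsVelocity (θ t) v) (hu : IsVelocity (η t) u)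
    (heqθ : ∀ φ, IsTest φ →
      HasDerivWithinAt (fun s => helmholtz a (θ s) φ) (negDiv v (θ t) φ) I t)
    (heqη : ∀ φ, IsTest φ →
      HasDerivWithinAt (fun s => ∫ x, η s x * φ x ∂μ) (negDiv u (η t) φ) I t)
    {M N : ℝ} (hM : √(∑ j, gradNormSq (weakPartial j (η t))) ≤ M)
    (hN : ∑ j, ‖derivWithin (fun s => weakPartial j (η s)) I t‖ ^ 2 ≤ N) :
    |2 * (inner ℝ (η t - θ t) (derivWithin η I t - derivWithin θ I t) +
      a ^ 2 * ∑ j, inner ℝ (weakPartial j (η t - θ t))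
        (derivWithin (fun s => weakPartial j (η s)) I t -
          derivWithin (fun s => weakPartial j (θ s)) I t))| ≤
      (60 * Real.pi * M + 1) * energy a (η t - θ t) + a ^ 2 * N := by
  have hF := hasSum_coeff_derivWithin_helmholtz hI hθ.contDiffOn ht a hv heqθ
  have hG := hasSum_coeff_derivWithin_helmholtz hI hη.contDiffOn ht 0 hu
    (by simpa only [helmholtz_zero] using heqη)
  have hwsub : coeff (η t - θ t) = coeff (η t) - coeff (θ t) := funext fun k => coeff_sub _ _ k
  have hw0 : MeanZero (η t - θ t) := by
    have h1 : ∫ x, η t x ∂μ = 0 := hη.mean_zero t ht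
    have h2 : ∫ x, θ t x ∂μ = 0 := hθ.mean_zero t ht
    have h3 := integral_congr_ae (Lp.coeFn_sub (η t) (θ t))
    simp only [Pi.sub_apply] at h3
    rw [integral_sub (integrable_coeFn _) (integrable_coeFn _), h1, h2, sub_zero] at h3
    exact h3
  have hw1 := ((hη.memH1 t ht).sub (hθ.memH1 t ht)).isDotH1Family hw0
  have hw2 := hasSum_norm_coeff_sq (η t - θ t)
  obtain ⟨S, hS, hSle⟩ := exists_hasSum_conj_mul_sub (fun k => coeff_neg (θ t) k)
    (fun k => coeff_neg (η t) k) ((hθ.memH1 t ht).isDotH1Family (hθ.mean_zero t ht))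
    ((hη.memH1 t ht).isDotH1Family (hη.mean_zero t ht)) (hwsub ▸ hw1)
    (hwsub ▸ hw2.summable) hη2.summable_len_sq hF hG
  rw [← hwsub] at hS hSle
  rw [hw2.tsum_eq] at hSle
  rw [energy_balance hI hθ hη ht a (S := S) (by
    refine hS.congr_fun fun k => ?_
    simp)]
  have hSM : |S.re| ≤ 30 * Real.pi * M * ‖η t - θ t‖ ^ 2 := by
    refine (Complex.abs_re_le_norm S).trans (hSle.trans ?_)
    gcongr
    exact hη2.ell2_len_sq_le.trans hM
  have hin : ∀ x y : L2, |2 * (inner ℝ x y : ℝ)| ≤ ‖x‖ ^ 2 + ‖y‖ ^ 2 := by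
    intro x y
    rw [abs_mul, abs_two]
    nlinarith [abs_real_inner_le_norm x y, sq_nonneg (‖x‖ - ‖y‖)]
  have h1 := hin (weakPartial 0 (η t - θ t)) (derivWithin (fun s => weakPartial 0 (η s)) I t)
  have h2 := hin (weakPartial 1 (η t - θ t)) (derivWithin (fun s => weakPartial 1 (η s)) I t)
  have hM0 : 0 ≤ M := (Real.sqrt_nonneg _).trans hM
  rw [Fin.sum_univ_two] at hN ⊢
  have hsum : |2 * ((inner ℝ (weakPartial 0 (η t - θ t))
      (derivWithin (fun s => weakPartial 0 (η s)) I t) : ℝ) +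
      inner ℝ (weakPartial 1 (η t - θ t)) (derivWithin (fun s => weakPartial 1 (η s)) I t))| ≤
      gradNormSq (η t - θ t) + N := by
    rw [mul_add, gradNormSq, Fin.sum_univ_two]
    refine (abs_add_le _ _).trans ?_
    linarith
  have hfin : ∀ s i : ℝ, |2 * (s + a ^ 2 * i)| ≤ 2 * |s| + a ^ 2 * |2 * i| := by
    intro s i
    have : 2 * (s + a ^ 2 * i) = 2 * s + a ^ 2 * (2 * i) := by ring
    rw [this]
    refine (abs_add_le _ _).trans (le_of_eq ?_)
    rw [abs_mul, abs_two, abs_mul (a ^ 2), abs_of_nonneg (sq_nonneg a)]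
  refine (hfin _ _).trans ?_
  have h5 := mul_le_mul_of_nonneg_left hsum (sq_nonneg a)
  have h6 : 0 ≤ 60 * Real.pi * M * (a ^ 2 * gradNormSq (η t - θ t)) :=
    mul_nonneg (by positivity) (mul_nonneg (sq_nonneg a) (gradNormSq_nonneg _))
  rw [energy]
  nlinarith [sq_nonneg ‖η t - θ t‖]

/-! ### Grönwall's inequality in both time directions -/

theorem le_gronwallBound_of_abs_deriv_le {T K ε : ℝ} {E E' : ℝ → ℝ}
    (hE : ∀ t ∈ Icc (-T) T, HasDerivWithinAt E (E' t) (Icc (-T) T) t) (h0 : E 0 = 0)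
    (hE' : ∀ t ∈ Icc (-T) T, |E' t| ≤ K * |E t| + ε) {t : ℝ} (ht : t ∈ Icc 0 T) :
    |E t| ≤ gronwallBound 0 K ε t := by
  have hsub : Icc 0 T ⊆ Icc (-T) T := Icc_subset_Icc_left (by linarith [ht.1, ht.2])
  have h := norm_le_gronwallBound_of_norm_deriv_right_le (f := E) (f' := E') (δ := 0) (K := K)
    (ε := ε) (a := 0) (b := T) (fun s hs => (hE s (hsub hs)).continuousWithinAt.mono hsub)
    (fun s hs => (hE s (hsub ⟨hs.1, hs.2.le⟩)).mono_of_mem_nhdsWithin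
      (Icc_mem_nhdsGE_of_mem ⟨(hsub ⟨hs.1, hs.2.le⟩).1, hs.2⟩)) (by simp [h0])
    (fun s hs => hE' s (hsub ⟨hs.1, hs.2.le⟩)) t ht
  simpa using h

/-- The hypothesis bounds |E'|, so it survives the reflection s ↦ -s, which reduces negative times
to positive ones. -/
theorem abs_le_gronwallBound_of_abs_deriv_le {T K ε : ℝ} {E E' : ℝ → ℝ}
    (hE : ∀ t ∈ Icc (-T) T, HasDerivWithinAt E (E' t) (Icc (-T) T) t) (h0 : E 0 = 0)
    (hE' : ∀ t ∈ Icc (-T) T, |E' t| ≤ K * |E t| + ε) {t : ℝ} (ht : t ∈ Icc (-T) T) :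
    |E t| ≤ gronwallBound 0 K ε |t| := by
  rcases le_total 0 t with h | h
  · rw [abs_of_nonneg h]
    exact le_gronwallBound_of_abs_deriv_le hE h0 hE' ⟨h, ht.2⟩
  · rw [abs_of_nonpos h]
    have hmaps : MapsTo (fun s : ℝ => -s) (Icc (-T) T) (Icc (-T) T) := fun s hs =>
      ⟨neg_le_neg hs.2, by linarith [hs.1]⟩
    have := le_gronwallBound_of_abs_deriv_le (T := T) (K := K) (ε := ε)
      (E := fun s => E (-s)) (E' := fun s => E' (-s) * -1) (t := -t)
      (fun s hs => (hE (-s) (hmaps hs)).comp s (hasDerivAt_neg s).hasDerivWithinAt hmaps)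
      (by simpa using h0)
      (fun s hs => by simpa using hE' (-s) (hmaps hs)) ⟨by linarith, by linarith [ht.1]⟩
    simpa using this

end SQG

end

/-! ### Convergence of the regularized solutions -/

theorem theorem5 (T : ℝ) (hT : 0 < T) (θ₀ : SQG.L2) (hθ₀ : SQG.MemH2 θ₀)
    (hθ₀_mean : SQG.MeanZero θ₀) (θbar : ℝ → SQG.L2)
    (hθbar : SQG.IsRegularSolution T θ₀ θbar) :
    ∀ ε > 0, ∃ α₀ > 0, ∀ α : ℝ, 0 < α → α < α₀ →
      ∀ θ : ℝ → SQG.L2, SQG.IsRegularizedSolution α T θ₀ θ →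
        ∀ t ∈ Set.Icc (-T) T,
          ‖θbar t - θ t‖ ^ 2 + α ^ 2 * SQG.gradNormSq (θbar t - θ t) < ε := by
  intro ε hε
  have hI : UniqueDiffOn ℝ (Icc (-T) T) := uniqueDiffOn_Icc (by linarith)
  obtain ⟨M, hM⟩ : ∃ M, ∀ t ∈ Icc (-T) T,
      √(∑ j, SQG.gradNormSq (SQG.weakPartial j (θbar t))) ≤ M := by
    have hc : ContinuousOn (fun t => √(∑ j, SQG.gradNormSq (SQG.weakPartial j (θbar t))))
        (Icc (-T) T) :=
      (continuousOn_finsetSum _ fun j _ => continuousOn_finsetSum _ fun i _ =>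
        (hθbar.c0h2.continuousOn_weakPartial₂ i j).norm.pow 2).sqrt
    obtain ⟨M, hM⟩ := isCompact_Icc.bddAbove_image hc
    exact ⟨M, fun t ht => hM (mem_image_of_mem _ ht)⟩
  obtain ⟨N, hN⟩ : ∃ N, ∀ t ∈ Icc (-T) T,
      ∑ j, ‖derivWithin (fun s => SQG.weakPartial j (θbar s)) (Icc (-T) T) t‖ ^ 2 ≤ N := by
    have hc : ContinuousOn (fun t => ∑ j, ‖derivWithin (fun s => SQG.weakPartial j (θbar s))
        (Icc (-T) T) t‖ ^ 2) (Icc (-T) T) :=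
      continuousOn_finsetSum _ fun j _ =>
        ((hθbar.c1h1.contDiffOn_weakPartial j).continuousOn_derivWithin hI le_rfl).norm.pow 2
    obtain ⟨N, hN⟩ := isCompact_Icc.bddAbove_image hc
    exact ⟨N, fun t ht => hN (mem_image_of_mem _ ht)⟩
  have h0mem : (0 : ℝ) ∈ Icc (-T) T := ⟨by linarith, hT.le⟩
  have hM0 : 0 ≤ M := (Real.sqrt_nonneg _).trans (hM 0 h0mem)
  have hN0 : 0 ≤ N := (Finset.sum_nonneg fun _ _ => sq_nonneg _).trans (hN 0 h0mem)
  set K := 60 * Real.pi * M + 1 with hK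
  have hKpos : 0 < K := by positivity
  -- Grönwall with zero initial energy and forcing α²N bounds the energy by α²C. In the choice of
  -- α₀, C + 1 avoids division by zero.
  set C := N / K * Real.exp (K * T) with hC
  have hC0 : 0 ≤ C := by positivity
  refine ⟨√(ε / (C + 1)), Real.sqrt_pos.2 (by positivity), fun α hα hlt θ hθ t ht => ?_⟩
  have hαsq : α ^ 2 < ε / (C + 1) := (Real.lt_sqrt hα.le).1 hlt
  have hgr := SQG.abs_le_gronwallBound_of_abs_deriv_le (K := K) (ε := α ^ 2 * N)
    (fun s hs => SQG.hasDerivWithinAt_energy hθ.c1h1 hθbar.c1h1 hs α)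
    (by
      have h0 := (hθbar.c1h1.memH1 0 h0mem).weakPartial_sub (hθ.c1h1.memH1 0 h0mem)
      simp only [SQG.energy, SQG.gradNormSq, h0]
      simp [hθbar.initial, hθ.initial])
    (fun s hs => by
      obtain ⟨v, hv, heq⟩ := hθ.equation s hs
      obtain ⟨u, hu, heq'⟩ := hθbar.equation s hs
      rw [abs_of_nonneg (SQG.energy_nonneg α (θbar s - θ s))]
      exact SQG.abs_energy_deriv_le hI hθ.c1h1 hθbar.c1h1 hs (hθbar.c0h2.memH2 s hs) α hv hu
        heq heq' (hM s hs) (hN s hs)) ht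
  simp only [gronwallBound_of_K_ne_0 hKpos.ne', zero_mul, zero_add] at hgr
  have hexp : Real.exp (K * |t|) ≤ Real.exp (K * T) :=
    Real.exp_le_exp.2 (mul_le_mul_of_nonneg_left (abs_le.2 ht) hKpos.le)
  calc ‖θbar t - θ t‖ ^ 2 + α ^ 2 * SQG.gradNormSq (θbar t - θ t)
      ≤ α ^ 2 * N / K * (Real.exp (K * |t|) - 1) := (le_abs_self _).trans hgr
    _ ≤ α ^ 2 * N / K * Real.exp (K * T) := by
        gcongr
        linarith
    _ = α ^ 2 * C := by rw [hC]; ring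
    _ ≤ α ^ 2 * (C + 1) := by gcongr; linarith
    _ < ε := (lt_div_iff₀ (by positivity)).1 hαsq
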